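/- Let $L^2(0,\infty)$ be the complex Hilbert space with inner product $\langle u,v\rangle=\int_0^\infty u\,\overline v\,dx$. Let $\mathcal W=W^{1,2}_{\rm loc}[0,\infty)$ be the space of continuous functions $f$ on $[0,\infty)$ for which there is $f'\in L^2_{\rm loc}[0,\infty)$ (square integrable on $[0,a]$ for every $a>0$) with $f(x)=f(0)+\int_0^x f'(s)\,ds$ for all $x\ge 0$; $f'$, which is unique up to null sets, is called the weak derivative of $f$. A function given only almost everywhere is said to lie in $\mathcal W$ if it agrees a.e. with an element of $\mathcal W$, whose weak derivative it is then assigned. Let $\phi\in L^2(0,\infty)\cap\mathcal W$ be real-valued with $\phi(x)>0$ for all $x\ge 0$. Put $\psi(x)=\phi(x)\int_0^x\phi(s)^{-2}\,ds$ and $$G(x,y)=\begin{cases}\psi(x)\phi(y)&\text{if }0\le x\le y,\\ \phi(x)\psi(y)&\text{if }0\le y\le x.\end{cases}$$ Assume that $G(\cdot,\cdot)$ is the integral kernel of a bounded operator on $L^2(0,\infty)$, also denoted by $G$: for every $f\in L^2(0,\infty)$, $(Gf)(x)=\int_0^\infty G(x,y)f(y)\,dy$ for almost every $x>0$. Let $\mathcal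 D$ be the space of complex functions $g$ on $[0,\infty)$ such that (D1) $g\in L^2(0,\infty)\cap\mathcal W$; (D2) $g(0)=0$; (D3) $\phi g'-\phi' g\in\mathcal W$; (D4) $\phi^{-1}(\phi g'-\phi' g)'\in L^2(0,\infty)$; (D5) $\lim_{x\to\infty}g(x)/\psi(x)=0$. Then $G$ is injective, and the operator $H=G^{-1}$, whose domain is the range of $G$, is self-adjoint with $\operatorname{Dom}(H)=\mathcal D$ (identifying functions in $\mathcal D$ with their classes in $L^2(0,\infty)$). For all $g\in\mathcal D$, $$Hg=\phi^{-1}(\phi' g-\phi g')'.$$ Moreover $\operatorname{Spec}(H)\subseteq[\|G\|^{-1},\infty)$, and every $g\in\mathcal D$ satisfies the boundary condition $g(0)=0$. Finally, for all $g_1,g_2\in\mathcal D$, the functions $g_1/\phi$ and $\overline{g_2}/\phi$ lie in $\mathcal W$, the two integrals below converge absolutely, and $$\langle Hg_1,g_2\rangle=\int_0^\infty(\phi g_1'-\phi' g_1)(\phi\,\overline{g_2'}-\phi'\,\overline{g_2})\,\phi^{-2}\,dx=\int_0^\infty\Big(\frac{g_1}{\phi}\Big)'\Big(\frac{\overline{g_2}}{\phi}\Big)'\phi^2\,dx.$$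 -/

import Mathlib

open MeasureTheory Set Filter Topology

noncomputable section

/-- Lebesgue measure on the half-line `(0,∞)`. -/
abbrev halfLine : Measure ℝ := volume.restrict (Ioi (0 : ℝ))

/-- The complex Hilbert space `L²(0,∞)`. -/
abbrev L2HalfLine : Type := Lp ℂ 2 halfLine

/-- `f ∈ L²_loc[0,∞)`: square integrable on `(0,a]` for every `a`. -/
def MemL2Loc {E : Type*} [NormedAddCommGroup E] (f : ℝ → E) : Prop :=
  ∀ a : ℝ, MemLp f 2 (volume.restrict (Ioc 0 a))

/-- `f` is continuous on `[0,∞)`, and `f' ∈ L²_loc[0,∞)` satisfies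
`f(x) = f(0) + ∫_0^x f'(s) ds` for all `x ≥ 0`. Values on `(-∞,0)` play no role. -/
structure HasWeakDeriv {E : Type*} [NormedAddCommGroup E] [NormedSpace ℝ E]
    (f f' : ℝ → E) : Prop where
  continuousOn : ContinuousOn f (Ici 0)
  memL2Loc : MemL2Loc f'
  eq_integral : ∀ x : ℝ, 0 ≤ x → f x = f 0 + ∫ s in (0 : ℝ)..x, f' s

/-- The space `𝒲 = W^{1,2}_loc[0,∞)`, as a space of continuous functions on `[0,∞)`. -/
def MemW {E : Type*} [NormedAddCommGroup E] [NormedSpace ℝ E] (f : ℝ → E) : Prop :=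
  ∃ f' : ℝ → E, HasWeakDeriv f f'

/-- `f`, given up to null sets only, is a.e. on `(0,∞)` equal to an element of `𝒲`. -/
def AEMemW {E : Type*} [NormedAddCommGroup E] [NormedSpace ℝ E] (f : ℝ → E) : Prop :=
  ∃ f' k : ℝ → E, f =ᵐ[halfLine] k ∧ HasWeakDeriv k f'

open Classical in
/-- The weak derivative (determined up to null sets) of a function that is a.e. equal to an element
of `𝒲`; zero for other functions. -/
def weakDeriv {E : Type*} [NormedAddCommGroup E] [NormedSpace ℝ E] (f : ℝ → E) : ℝ → E :=
  if h : AEMemW f then h.choose else 0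

/-- Weak derivatives are unique up to null sets. -/
theorem HasWeakDeriv.ae_unique {E : Type*} [NormedAddCommGroup E] [NormedSpace ℝ E] [CompleteSpace E]
    {f f' k k' : ℝ → E} (h : HasWeakDeriv f f') (h2 : HasWeakDeriv k k') (e : f =ᵐ[halfLine] k) :
    f' =ᵐ[halfLine] k' := by
  have e1 : EqOn f k (Ici 0) := by
    have hs : EqOn f k (Ioi 0) :=
      Measure.eqOn_open_of_ae_eq e isOpen_Ioi (h.continuousOn.mono Ioi_subset_Ici_self)
        (h2.continuousOn.mono Ioi_subset_Ici_self)
    refine hs.of_subset_closure h.continuousOn h2.continuousOn Ioi_subset_Ici_self ?_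
    rw [closure_Ioi]
  have ii : ∀ {p : ℝ → E}, MemL2Loc p → ∀ n : ℕ, IntervalIntegrable p volume 0 n := by
    intro p hp n
    rw [intervalIntegrable_iff_integrableOn_Ioc_of_le (by positivity)]
    exact (hp n).integrable (by norm_num)
  have key : ∀ n : ℕ, ∀ᵐ x, x ∈ Ioo (0:ℝ) n → f' x = k' x := by
    intro n
    have A := (ii h.memL2Loc n).ae_hasDerivAt_integral
    have B := (ii h2.memL2Loc n).ae_hasDerivAt_integral
    filter_upwards [A, B] with x hA hB hx
    have hn : (0:ℝ) ≤ n := hx.1.le.trans hx.2.le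
    have hm : x ∈ uIcc (0:ℝ) n := by rw [uIcc_of_le hn]; exact ⟨hx.1.le, hx.2.le⟩
    have a := hA hm 0 (by simp)
    have b := hB hm 0 (by simp)
    refine a.unique (b.congr_of_eventuallyEq ?_)
    filter_upwards [Ioi_mem_nhds hx.1] with y hy
    have hy' : (0:ℝ) ≤ y := le_of_lt hy
    have u := h.eq_integral y hy'
    have v := h2.eq_integral y hy'
    rw [e1 hy', e1 (by simp : (0:ℝ) ∈ Ici (0:ℝ)), v] at u
    exact (add_left_cancel u).symm
  rw [EventuallyEq, ae_restrict_iff' measurableSet_Ioi]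
  filter_upwards [ae_all_iff.2 key] with x hx h0
  obtain ⟨n, hn⟩ := exists_nat_gt x
  exact hx n ⟨h0, hn⟩

/-- The chosen weak derivative agrees a.e. with any given one. -/
theorem HasWeakDeriv.weakDeriv_ae_eq {E : Type*} [NormedAddCommGroup E] [NormedSpace ℝ E] [CompleteSpace E]
    {f f' k : ℝ → E} (e : f =ᵐ[halfLine] k) (h : HasWeakDeriv k f') :
    weakDeriv f =ᵐ[halfLine] f' := by
  have H : AEMemW f := ⟨f', k, e, h⟩
  obtain ⟨k2, e2, h2⟩ := H.choose_spec
  rw [weakDeriv, dif_pos H]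
  exact HasWeakDeriv.ae_unique h2 h (e2.symm.trans e)

/-- `ψ(x) = φ(x) ∫_0^x φ(s)⁻² ds`. -/
def psi (φ : ℝ → ℝ) (x : ℝ) : ℝ := φ x * ∫ s in (0 : ℝ)..x, (φ s ^ 2)⁻¹

/-- The Green function: `ψ(x)φ(y)` for `x ≤ y`, and `φ(x)ψ(y)` for `y ≤ x`. -/
def greenKernel (φ : ℝ → ℝ) (x y : ℝ) : ℝ :=
  if x ≤ y then psi φ x * φ y else φ x * psi φ y

/-- The bounded operator `G` on `L²(0,∞)` has integral kernel `G(x,y)`. -/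
def IsGreenOperator (φ : ℝ → ℝ) (G : L2HalfLine →L[ℂ] L2HalfLine) : Prop :=
  ∀ f : L2HalfLine,
    (G f : ℝ → ℂ) =ᵐ[halfLine] fun x ↦ ∫ y in Ioi (0 : ℝ), (greenKernel φ x y : ℂ) * f y

/-- `φ g' - φ' g` for a complex function `g`, with weak derivatives. -/
def wronskian (φ : ℝ → ℝ) (g : ℝ → ℂ) (x : ℝ) : ℂ :=
  (φ x : ℂ) * weakDeriv g x - ((weakDeriv φ x : ℝ) : ℂ) * g x

/-- The linear space `𝒟` of functions on `[0,∞)`. -/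
structure MemDomainD (φ : ℝ → ℝ) (g : ℝ → ℂ) : Prop where
  memLp : MemLp g 2 halfLine
  memW : MemW g
  apply_zero : g 0 = 0
  wronskian_memW : AEMemW (wronskian φ g)
  deriv_memLp : MemLp (fun x ↦ (φ x : ℂ)⁻¹ * weakDeriv (wronskian φ g) x) 2 halfLine
  tendsto : Tendsto (fun x ↦ g x / (psi φ x : ℂ)) atTop (𝓝 0)

/-- The inverse of an everywhere defined operator, with domain the range of that operator
(meaningful when the operator is injective). -/
def inverseOperator {E : Type*} [NormedAddCommGroup E] [NormedSpace ℂ E]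
    (G : E →L[ℂ] E) : E →ₗ.[ℂ] E :=
  ((G : E →ₗ[ℂ] E).toPMap ⊤).inverse

/-- The resolvent set of a partially defined operator `T`: those `z` for which `T - z` maps the
domain of `T` bijectively onto the space, with bounded inverse `R`. -/
def resolventSetPMap {E : Type*} [NormedAddCommGroup E] [NormedSpace ℂ E]
    (T : E →ₗ.[ℂ] E) : Set ℂ :=
  {z | ∃ R : E →L[ℂ] E,
    (∀ v : E, ∃ u : T.domain, (u : E) = R v ∧ T u - z • (u : E) = v) ∧
    ∀ u : T.domain, R (T u - z • (u : E)) = u}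

/-- The spectrum of a partially defined operator. -/
def spectrumPMap {E : Type*} [NormedAddCommGroup E] [NormedSpace ℂ E]
    (T : E →ₗ.[ℂ] E) : Set ℂ :=
  (resolventSetPMap T)ᶜ

end

/-! ### Weak derivatives on the half-line via absolute continuity. -/

section WeakDerivativeCalculus

/-! The kernel equals φ(x)φ(y)∫_0^{min(x,y)} φ⁻², so Fubini gives Gf = φq, where q' = φ⁻²T, q(0) = 0
and T(s) = ∫_s^∞ φf (`integral_greenKernel_mul`). For g = φq the Wronskian φg' - φ'g = φ²(g/φ)' is
T, and T' = -φf. Hence the differential expression recovers f from Gf.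

Conversely, for g in 𝒟 set f = -φ⁻¹W' with W the Wronskian. Then W = T + c, and integrating (g/φ)' =
φ⁻²W from g(0) = 0 yields g = φq + cψ. Since φ ∈ L², ∫_0^x φ⁻² → ∞, while T → 0; so φq/ψ → 0, and
(D5) forces c = 0. Thus 𝒟 is exactly the range of G (`exists_eqOn_green`).

A second use of Fubini gives ⟨a, Gb⟩ = ∫ T_a conj(T_b) φ⁻² (`integral_mul_star_green`), with
absolute convergence because G|b| ∈ L². This makes G symmetric and positive, and it is the quadratic
form of H once T is read as the Wronskian or as φ²(g/φ)'. The rest is abstract: the inverse of an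
injective bounded symmetric operator is self-adjoint (`isSelfAdjoint_inverseOperator`), and
inversion maps Spec(H) into Spec(G) ⊆ [0, ‖G‖] (`inv_mem_spectrum_of_mem_spectrumPMap`). -/

theorem AbsolutelyContinuousOnInterval.of_dist_le {X Y : Type*} [PseudoMetricSpace X]
    [PseudoMetricSpace Y] {f : ℝ → X} {F : ℝ → Y} {a b : ℝ}
    (hF : AbsolutelyContinuousOnInterval F a b)
    (h : ∀ x ∈ uIcc a b, ∀ y ∈ uIcc a b, dist (f x) (f y) ≤ dist (F x) (F y)) :
    AbsolutelyContinuousOnInterval f a b := by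
  rw [absolutelyContinuousOnInterval_iff] at hF ⊢
  intro ε hε
  obtain ⟨δ, hδ, H⟩ := hF ε hε
  refine ⟨δ, hδ, fun E hE hs ↦ lt_of_le_of_lt (Finset.sum_le_sum fun i hi ↦ ?_) (H E hE hs)⟩
  exact h _ (hE.1 i hi).1 _ (hE.1 i hi).2

variable {E : Type*} [NormedAddCommGroup E]

theorem MemL2Loc.intervalIntegrable {p : ℝ → E} (hp : MemL2Loc p) {a b : ℝ} (ha : 0 ≤ a)
    (hb : 0 ≤ b) : IntervalIntegrable p volume a b := by
  have key : ∀ c : ℝ, 0 ≤ c → IntervalIntegrable p volume 0 c := by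
    intro c hc
    rw [intervalIntegrable_iff_integrableOn_Ioc_of_le hc]
    exact (hp c).integrable (by norm_num)
  exact (key a ha).symm.trans (key b hb)

theorem MemL2Loc.congr_ae {p q : ℝ → E} (hp : MemL2Loc p) (h : p =ᵐ[halfLine] q) :
    MemL2Loc q := fun a ↦
  (hp a).ae_eq (ae_restrict_of_ae_restrict_of_subset Ioc_subset_Ioi_self h)

theorem MemLp.memL2Loc {p : ℝ → E} (hp : MemLp p 2 halfLine) : MemL2Loc p := fun _ ↦
  hp.mono_measure (Measure.restrict_mono Ioc_subset_Ioi_self le_rfl)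

theorem ContinuousOn.memL2Loc {c : ℝ → E} (hc : ContinuousOn c (Ici 0)) : MemL2Loc c := by
  intro a
  have h1 : ContinuousOn c (Icc 0 a) := hc.mono Icc_subset_Ici_self
  obtain ⟨C, hC⟩ := isCompact_Icc.exists_bound_of_continuousOn h1
  refine MemLp.of_bound ((h1.mono Ioc_subset_Icc_self).aestronglyMeasurable measurableSet_Ioc) C ?_
  filter_upwards [ae_restrict_mem measurableSet_Ioc] with x hx using hC x (Ioc_subset_Icc_self hx)

theorem MemL2Loc.add {p q : ℝ → E} (hp : MemL2Loc p) (hq : MemL2Loc q) :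
    MemL2Loc (fun x ↦ p x + q x) := fun a ↦ (hp a).add (hq a)

theorem MemL2Loc.neg {p : ℝ → E} (hp : MemL2Loc p) : MemL2Loc (fun x ↦ - p x) :=
  fun a ↦ (hp a).neg

variable [NormedSpace ℝ E]

theorem MemL2Loc.smul_continuousOn {c : ℝ → ℝ} {p : ℝ → E} (hp : MemL2Loc p)
    (hc : ContinuousOn c (Ici 0)) : MemL2Loc (fun x ↦ c x • p x) := by
  intro a
  have h1 : ContinuousOn c (Icc 0 a) := hc.mono Icc_subset_Ici_self
  obtain ⟨C, hC⟩ := isCompact_Icc.exists_bound_of_continuousOn h1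
  refine MemLp.of_le_mul (c := C) (hp a)
    (((h1.mono Ioc_subset_Icc_self).aestronglyMeasurable measurableSet_Ioc).smul
      (hp a).aestronglyMeasurable) ?_
  filter_upwards [ae_restrict_mem measurableSet_Ioc] with x hx
  rw [norm_smul]
  exact mul_le_mul_of_nonneg_right (hC x (Ioc_subset_Icc_self hx)) (norm_nonneg _)

theorem ContinuousOn.smul_memL2Loc {c : ℝ → ℝ} {p : ℝ → E} (hp : ContinuousOn p (Ici 0))
    (hc : MemL2Loc c) : MemL2Loc (fun x ↦ c x • p x) := by
  intro a
  have h1 : ContinuousOn p (Icc 0 a) := hp.mono Icc_subset_Ici_self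
  obtain ⟨C, hC⟩ := isCompact_Icc.exists_bound_of_continuousOn h1
  refine MemLp.of_le_mul (c := C) (hc a) ((hc a).aestronglyMeasurable.smul
    ((h1.mono Ioc_subset_Icc_self).aestronglyMeasurable measurableSet_Ioc)) ?_
  filter_upwards [ae_restrict_mem measurableSet_Ioc] with x hx
  rw [norm_smul, mul_comm]
  exact mul_le_mul_of_nonneg_right (hC x (Ioc_subset_Icc_self hx)) (norm_nonneg _)

theorem HasWeakDeriv.absolutelyContinuousOnInterval {f f' : ℝ → E} (h : HasWeakDeriv f f')
    {a : ℝ} (ha : 0 ≤ a) : AbsolutelyContinuousOnInterval f 0 a := by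
  have hi := h.memL2Loc.intervalIntegrable le_rfl ha
  refine (hi.norm.absolutelyContinuousOnInterval_intervalIntegral (c := 0) (by simp)).of_dist_le ?_
  intro x hx y hy
  rw [uIcc_of_le ha] at hx hy
  have I := fun z (hz : 0 ≤ z) ↦ h.memL2Loc.intervalIntegrable le_rfl hz
  rw [h.eq_integral x hx.1, h.eq_integral y hy.1, dist_add_left, dist_eq_norm, Real.dist_eq,
    intervalIntegral.integral_interval_sub_left (I x hx.1) (I y hy.1),
    intervalIntegral.integral_interval_sub_left (I x hx.1).norm (I y hy.1).norm]
  exact intervalIntegral.norm_integral_le_abs_integral_norm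

theorem ae_halfLine_of_forall_nat {P : ℝ → Prop}
    (h : ∀ n : ℕ, ∀ᵐ x, x ∈ Ioo (0 : ℝ) n → P x) : ∀ᵐ x ∂halfLine, P x := by
  rw [ae_restrict_iff' measurableSet_Ioi]
  filter_upwards [ae_all_iff.2 h] with x hx h0
  obtain ⟨n, hn⟩ := exists_nat_gt x
  exact hx n ⟨h0, hn⟩

theorem HasWeakDeriv.ae_hasDerivAt [CompleteSpace E] {f f' : ℝ → E} (h : HasWeakDeriv f f') :
    ∀ᵐ x ∂halfLine, HasDerivAt f (f' x) x := by
  refine ae_halfLine_of_forall_nat fun n ↦ ?_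
  have hn : (0 : ℝ) ≤ n := Nat.cast_nonneg n
  filter_upwards [(h.memL2Loc.intervalIntegrable le_rfl hn).ae_hasDerivAt_integral] with x hx hm
  have hm' : x ∈ uIcc (0 : ℝ) n := by rw [uIcc_of_le hn]; exact Ioo_subset_Icc_self hm
  refine ((hx hm' 0 (by simp)).const_add (f 0)).congr_of_eventuallyEq ?_
  filter_upwards [Ioi_mem_nhds hm.1] with y hy using h.eq_integral y (le_of_lt hy)

theorem HasWeakDeriv.of_integral {f f' : ℝ → E} {c : E} (hf' : MemL2Loc f')
    (h : ∀ x, 0 ≤ x → f x = c + ∫ s in (0 : ℝ)..x, f' s) : HasWeakDeriv f f' := by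
  have h0 : f 0 = c := by simpa using h 0 le_rfl
  refine ⟨?_, hf', fun x hx ↦ by rw [h0, h x hx]⟩
  have key : ∀ a : ℝ, 0 ≤ a → ContinuousOn f (Icc 0 a) := by
    intro a ha
    have := intervalIntegral.continuousOn_primitive_interval
      (f := f') (μ := volume) (a := 0) (b := a)
      (by
        have := hf'.intervalIntegrable le_rfl ha
        rwa [intervalIntegrable_iff_integrableOn_Icc_of_le ha, ← uIcc_of_le ha] at this)
    rw [uIcc_of_le ha] at this
    exact (this.const_add c).congr fun x hx ↦ h x hx.1
  intro x hx
  have hx' : (0 : ℝ) ≤ x := hx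
  refine ((key (x + 1) (by linarith)) x ⟨hx, by linarith⟩).mono_of_mem_nhdsWithin ?_
  rw [mem_nhdsWithin]
  exact ⟨Iio (x + 1), isOpen_Iio, by simp, fun y hy ↦ ⟨hy.2, le_of_lt hy.1⟩⟩

/-- Subtracting the primitive of k' leaves an absolutely continuous function with derivative zero
a.e., hence a constant. Product and reciprocal rules thereby reduce to pointwise differentiation. -/
theorem HasWeakDeriv.of_absolutelyContinuousOnInterval [CompleteSpace E] {k k' : ℝ → E}
    (hac : ∀ a : ℝ, 0 ≤ a → AbsolutelyContinuousOnInterval k 0 a) (hk' : MemL2Loc k')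
    (hd : ∀ᵐ x ∂halfLine, HasDerivAt k (k' x) x) : HasWeakDeriv k k' := by
  refine HasWeakDeriv.of_integral (c := k 0) hk' fun a ha ↦ ?_
  have P : HasWeakDeriv (fun x ↦ ∫ s in (0 : ℝ)..x, k' s) k' :=
    HasWeakDeriv.of_integral (c := 0) hk' fun x _ ↦ (zero_add _).symm
  have hac' := (hac a ha).fun_sub (P.absolutelyContinuousOnInterval ha)
  obtain ⟨C, hC⟩ := hac'.const_of_ae_hasDerivAt_zero (by
    have h1 := P.ae_hasDerivAt
    rw [ae_restrict_iff' measurableSet_Ioi] at h1 hd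
    -- The hypotheses on derivatives concern x > 0 only; the endpoint 0 is discarded as a null set.
    have h0 : ∀ᵐ x : ℝ, x ≠ 0 := by simp [ae_iff, measure_singleton]
    filter_upwards [h1, hd, h0] with x hx1 hx2 hx0 hx
    rw [uIcc_of_le ha] at hx
    have hx' : x ∈ Ioi (0 : ℝ) := lt_of_le_of_ne hx.1 (Ne.symm hx0)
    have := (hx2 hx').fun_sub (hx1 hx')
    rwa [sub_self] at this)
  have e0 := hC 0 (by simp)
  have ea := hC a (by simp)
  simp only [intervalIntegral.integral_same, sub_zero] at e0
  rw [e0, ← ea]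
  abel

theorem HasWeakDeriv.congr_ae_deriv {f f' k' : ℝ → E} (h : HasWeakDeriv f f')
    (e : f' =ᵐ[halfLine] k') : HasWeakDeriv f k' := by
  refine ⟨h.continuousOn, h.memL2Loc.congr_ae e, fun x hx ↦ ?_⟩
  rw [h.eq_integral x hx]
  congr 1
  refine intervalIntegral.integral_congr_ae ?_
  rw [EventuallyEq, ae_restrict_iff' measurableSet_Ioi] at e
  filter_upwards [e] with y hy hy'
  rw [uIoc_of_le hx] at hy'
  exact hy hy'.1

theorem HasWeakDeriv.congr {f f' k : ℝ → E} (h : HasWeakDeriv f f')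
    (e : EqOn k f (Ici 0)) : HasWeakDeriv k f' :=
  ⟨h.continuousOn.congr e, h.memL2Loc, fun x hx ↦ by
    rw [e hx, e (by simp : (0 : ℝ) ∈ Ici (0 : ℝ))]; exact h.eq_integral x hx⟩

theorem HasWeakDeriv.eqOn_of_ae_eq {f f' k k' : ℝ → E} (h : HasWeakDeriv f f')
    (h2 : HasWeakDeriv k k') (e : f =ᵐ[halfLine] k) : EqOn f k (Ici 0) := by
  have hs : EqOn f k (Ioi 0) :=
    Measure.eqOn_open_of_ae_eq e isOpen_Ioi (h.continuousOn.mono Ioi_subset_Ici_self)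
      (h2.continuousOn.mono Ioi_subset_Ici_self)
  refine hs.of_subset_closure h.continuousOn h2.continuousOn Ioi_subset_Ici_self ?_
  rw [closure_Ioi]

theorem HasWeakDeriv.neg {f f' : ℝ → E} (h : HasWeakDeriv f f') :
    HasWeakDeriv (fun x ↦ - f x) (fun x ↦ - f' x) := by
  refine ⟨h.continuousOn.neg, h.memL2Loc.neg, fun x hx ↦ ?_⟩
  rw [intervalIntegral.integral_neg, h.eq_integral x hx, neg_add]

theorem HasWeakDeriv.smul [CompleteSpace E] {c c' : ℝ → ℝ} {f f' : ℝ → E} (hc : HasWeakDeriv c c')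
    (hf : HasWeakDeriv f f') :
    HasWeakDeriv (fun x ↦ c x • f x) (fun x ↦ c x • f' x + c' x • f x) := by
  refine .of_absolutelyContinuousOnInterval (fun a ha ↦
    (hc.absolutelyContinuousOnInterval ha).fun_smul (hf.absolutelyContinuousOnInterval ha))
    ((hf.memL2Loc.smul_continuousOn hc.continuousOn).add
      (hf.continuousOn.smul_memL2Loc hc.memL2Loc)) ?_
  filter_upwards [hc.ae_hasDerivAt, hf.ae_hasDerivAt] with x h1 h2 using h1.smul h2

theorem HasWeakDeriv.inv {c c' : ℝ → ℝ} (hc : HasWeakDeriv c c') (hpos : ∀ x, 0 ≤ x → 0 < c x) :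
    HasWeakDeriv (fun x ↦ (c x)⁻¹) (fun x ↦ (-(c x ^ 2)⁻¹) • c' x) := by
  have hcont : ContinuousOn (fun x ↦ -(c x ^ 2)⁻¹) (Ici 0) :=
    ((hc.continuousOn.pow 2).inv₀ fun x hx ↦ (pow_pos (hpos x hx) 2).ne').neg
  refine .of_absolutelyContinuousOnInterval (fun a ha ↦ ?_)
    (hc.memL2Loc.smul_continuousOn hcont) ?_
  · obtain ⟨z, hz, hmin⟩ := isCompact_Icc.exists_isMinOn (nonempty_Icc.2 ha)
      (hc.continuousOn.mono Icc_subset_Ici_self)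
    have hz0 := hpos z hz.1
    -- With m = min c > 0 on [0,a], inversion is Lipschitz on [m,∞) with constant m⁻².
    refine ((hc.absolutelyContinuousOnInterval ha).const_mul ((c z ^ 2)⁻¹)).of_dist_le ?_
    intro x hx y hy
    rw [uIcc_of_le ha] at hx hy
    have hx0 := hpos x hx.1
    have hy0 := hpos y hy.1
    have hzx : c z ≤ c x := hmin hx
    have hzy : c z ≤ c y := hmin hy
    rw [Real.dist_eq, Real.dist_eq, ← mul_sub, abs_mul, abs_of_pos (by positivity : 0 < (c z ^ 2)⁻¹),
      inv_sub_inv hx0.ne' hy0.ne', abs_div, abs_sub_comm, abs_of_pos (mul_pos hx0 hy0), div_eq_inv_mul]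
    gcongr
    rw [pow_two]
    gcongr
  · filter_upwards [hc.ae_hasDerivAt, ae_restrict_mem measurableSet_Ioi] with x h1 hx
    convert! h1.inv (hpos x (le_of_lt hx)).ne' using 1
    simp [smul_eq_mul, div_eq_mul_inv, mul_comm]

theorem HasWeakDeriv.star {f f' : ℝ → ℂ} (h : HasWeakDeriv f f') :
    HasWeakDeriv (fun x ↦ star (f x)) (fun x ↦ star (f' x)) := by
  refine ⟨continuous_star.comp_continuousOn h.continuousOn, fun a ↦ (h.memL2Loc a).star,
    fun x hx ↦ ?_⟩
  have e : (∫ s in (0 : ℝ)..x, Star.star (f' s)) = Star.star (∫ s in (0 : ℝ)..x, f' s) := by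
    rw [intervalIntegral.integral_of_le hx, intervalIntegral.integral_of_le hx]
    exact integral_conj
  rw [e, h.eq_integral x hx, star_add]

end WeakDerivativeCalculus

/-! ### Green potentials and their asymptotics. -/

noncomputable section

/-- The hypotheses on the weight `φ`: positive, in `W^{1,2}_loc[0,∞)` and square integrable. -/
structure IsPositiveL2Weight (φ : ℝ → ℝ) : Prop where
  pos : ∀ x : ℝ, 0 ≤ x → 0 < φ x
  memW : MemW φ
  memLp : MemLp φ 2 halfLine

/-- `∫_0^x φ(s)⁻² ds`. -/
def invSqIntegral (φ : ℝ → ℝ) (x : ℝ) : ℝ := ∫ s in (0 : ℝ)..x, (φ s ^ 2)⁻¹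

/-- `∫_x^∞ φ(y) f(y) dy`. -/
def tailIntegral (φ : ℝ → ℝ) (f : ℝ → ℂ) (x : ℝ) : ℂ := ∫ y in Ioi x, (φ y : ℂ) * f y

/-- `∫_0^x φ(s)⁻² ∫_s^∞ φ(y) f(y) dy ds`, the quotient by `φ` of the Green potential of `f`. -/
def greenQuotient (φ : ℝ → ℝ) (f : ℝ → ℂ) (x : ℝ) : ℂ :=
  ∫ s in (0 : ℝ)..x, (φ s ^ 2)⁻¹ • tailIntegral φ f s

theorem psi_eq (φ : ℝ → ℝ) (x : ℝ) : psi φ x = φ x * invSqIntegral φ x := rfl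

/-- The two cases merge into a min, which is what an exchange of integrals over {s ≤ x, s ≤ y}
produces. -/
theorem greenKernel_eq (φ : ℝ → ℝ) (x y : ℝ) :
    greenKernel φ x y = φ x * (φ y * invSqIntegral φ (min x y)) := by
  unfold greenKernel
  split_ifs with h
  · rw [psi_eq, min_eq_left h]; ring
  · rw [psi_eq, min_eq_right (le_of_not_ge h)]

theorem tailIntegral_congr {φ : ℝ → ℝ} {f g : ℝ → ℂ} (h : f =ᵐ[halfLine] g) {x : ℝ} (hx : 0 ≤ x) :
    tailIntegral φ f x = tailIntegral φ g x := by
  refine integral_congr_ae ?_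
  filter_upwards [ae_restrict_of_ae_restrict_of_subset (Ioi_subset_Ioi hx) h] with y hy
  rw [hy]

theorem greenQuotient_congr {φ : ℝ → ℝ} {f g : ℝ → ℂ} (h : f =ᵐ[halfLine] g) {x : ℝ}
    (hx : 0 ≤ x) : greenQuotient φ f x = greenQuotient φ g x := by
  refine intervalIntegral.integral_congr fun s hs ↦ ?_
  rw [uIcc_of_le hx] at hs
  simp only [tailIntegral_congr h hs.1]

namespace IsPositiveL2Weight

variable {φ : ℝ → ℝ} (w : IsPositiveL2Weight φ)
include w

theorem continuousOn : ContinuousOn φ (Ici 0) := w.memW.choose_spec.continuousOn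

theorem continuousOn_invSq : ContinuousOn (fun x ↦ (φ x ^ 2)⁻¹) (Ici 0) :=
  (w.continuousOn.pow 2).inv₀ fun x hx ↦ (pow_pos (w.pos x hx) 2).ne'

theorem intervalIntegrable_invSq {a b : ℝ} (ha : 0 ≤ a) (hb : 0 ≤ b) :
    IntervalIntegrable (fun x ↦ (φ x ^ 2)⁻¹) volume a b :=
  (ContinuousOn.memL2Loc w.continuousOn_invSq).intervalIntegrable ha hb

theorem invSqIntegral_sub {a b : ℝ} (ha : 0 ≤ a) (hb : 0 ≤ b) :
    invSqIntegral φ b - invSqIntegral φ a = ∫ s in a..b, (φ s ^ 2)⁻¹ :=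
  intervalIntegral.integral_interval_sub_left (w.intervalIntegrable_invSq le_rfl hb)
    (w.intervalIntegrable_invSq le_rfl ha)

theorem integrable_mul {f : ℝ → ℂ} (hf : MemLp f 2 halfLine) :
    Integrable (fun y ↦ (φ y : ℂ) * f y) halfLine :=
  MemLp.integrable_mul (p := 2) (q := 2) w.memLp.ofReal hf

theorem hasWeakDeriv_tailIntegral {f : ℝ → ℂ} (hf : MemLp f 2 halfLine) :
    HasWeakDeriv (tailIntegral φ f) (fun x ↦ -((φ x : ℂ) * f x)) := by
  have h1 : MemL2Loc (fun x ↦ (φ x : ℂ) * f x) := by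
    simpa [Complex.real_smul] using (MemLp.memL2Loc hf).smul_continuousOn w.continuousOn
  refine HasWeakDeriv.of_integral (c := tailIntegral φ f 0) h1.neg fun x hx ↦ ?_
  have hi : IntegrableOn (fun y ↦ (φ y : ℂ) * f y) (Ioi 0) := w.integrable_mul hf
  have hu : Ioc 0 x ∪ Ioi x = Ioi 0 := Ioc_union_Ioi_eq_Ioi hx
  have := setIntegral_union (f := fun y ↦ (φ y : ℂ) * f y) (μ := volume)
    (Set.Ioc_disjoint_Ioi_same (a := 0) (b := x)) measurableSet_Ioi
    (hi.mono_set Ioc_subset_Ioi_self) (hi.mono_set (Ioi_subset_Ioi hx))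
  rw [hu] at this
  rw [intervalIntegral.integral_neg, intervalIntegral.integral_of_le hx]
  simp only [tailIntegral]
  rw [this]
  ring

theorem tendsto_tailIntegral {f : ℝ → ℂ} (hf : MemLp f 2 halfLine) :
    Tendsto (tailIntegral φ f) atTop (𝓝 0) := by
  have h := w.hasWeakDeriv_tailIntegral hf
  have h2 := (intervalIntegral_tendsto_integral_Ioi 0 (w.integrable_mul hf) tendsto_id).const_sub
    (tailIntegral φ f 0)
  have e : tailIntegral φ f 0 - ∫ x in Ioi (0 : ℝ), (φ x : ℂ) * f x = 0 := sub_self _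
  rw [e] at h2
  refine h2.congr' ?_
  filter_upwards [eventually_ge_atTop (0 : ℝ)] with x hx
  rw [h.eq_integral x hx, intervalIntegral.integral_neg, sub_eq_add_neg]
  rfl

theorem continuousOn_invSq_smul_tailIntegral {f : ℝ → ℂ} (hf : MemLp f 2 halfLine) :
    ContinuousOn (fun s ↦ (φ s ^ 2)⁻¹ • tailIntegral φ f s) (Ici 0) :=
  w.continuousOn_invSq.smul (w.hasWeakDeriv_tailIntegral hf).continuousOn

theorem hasWeakDeriv_greenQuotient {f : ℝ → ℂ} (hf : MemLp f 2 halfLine) :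
    HasWeakDeriv (greenQuotient φ f) (fun s ↦ (φ s ^ 2)⁻¹ • tailIntegral φ f s) :=
  HasWeakDeriv.of_integral (c := 0)
    (ContinuousOn.memL2Loc (w.continuousOn_invSq_smul_tailIntegral hf))
    fun _ _ ↦ (zero_add _).symm

/-- From φ² + φ⁻² ≥ 2 and φ² integrable with total mass C, the integral is at least 2x - C. -/
theorem tendsto_invSqIntegral : Tendsto (invSqIntegral φ) atTop atTop := by
  have hsq : Integrable (fun x ↦ φ x ^ 2) halfLine := w.memLp.integrable_sq
  set C := ∫ x in Ioi (0 : ℝ), φ x ^ 2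
  refine tendsto_atTop_mono' atTop (f₁ := fun x : ℝ ↦ 2 * x - C) ?_
    (tendsto_atTop_add_const_right _ _ (tendsto_id.const_mul_atTop two_pos))
  filter_upwards [eventually_ge_atTop (0 : ℝ)] with x hx
  have hsx : IntervalIntegrable (fun x ↦ φ x ^ 2) volume 0 x := by
    rw [intervalIntegrable_iff_integrableOn_Ioc_of_le hx]
    exact hsq.mono_measure (Measure.restrict_mono Ioc_subset_Ioi_self le_rfl)
  have h1 : ∫ s in (0 : ℝ)..x, φ s ^ 2 ≤ C := by
    rw [intervalIntegral.integral_of_le hx]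
    exact setIntegral_mono_set hsq (ae_of_all _ fun s ↦ sq_nonneg _)
      (ae_of_all _ Ioc_subset_Ioi_self)
  have h2 : ∫ s in (0 : ℝ)..x, (2 : ℝ) ≤ ∫ s in (0 : ℝ)..x, (φ s ^ 2 + (φ s ^ 2)⁻¹) := by
    refine intervalIntegral.integral_mono_on hx intervalIntegrable_const
      (hsx.add (w.intervalIntegrable_invSq le_rfl hx)) fun s hs ↦ ?_
    have hp : 0 < φ s ^ 2 := pow_pos (w.pos s hs.1) 2
    have hm : φ s ^ 2 * (φ s ^ 2)⁻¹ = 1 := mul_inv_cancel₀ hp.ne'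
    have : 0 < (φ s ^ 2)⁻¹ := inv_pos.2 hp
    nlinarith [sq_nonneg (φ s ^ 2 - (φ s ^ 2)⁻¹)]
  rw [intervalIntegral.integral_add hsx (w.intervalIntegrable_invSq le_rfl hx),
    intervalIntegral.integral_const] at h2
  simp only [sub_zero, smul_eq_mul] at h2
  have : invSqIntegral φ x = ∫ s in (0 : ℝ)..x, (φ s ^ 2)⁻¹ := rfl
  linarith

/-- An argument of l'Hôpital type: the ratio of the two integrands is the tail integral, which tends
to 0, and the denominator diverges. -/
theorem tendsto_greenQuotient_div {f : ℝ → ℂ} (hf : MemLp f 2 halfLine) :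
    Tendsto (fun x ↦ greenQuotient φ f x / (invSqIntegral φ x : ℂ)) atTop (𝓝 0) := by
  rw [Metric.tendsto_nhds]
  intro ε hε
  have h1 := (Metric.tendsto_nhds.1 (w.tendsto_tailIntegral hf)) (ε / 2) (by positivity)
  obtain ⟨N, hN⟩ := eventually_atTop.1 (h1.and (eventually_ge_atTop 0))
  have hN0 : 0 ≤ N := (hN N le_rfl).2
  have hI : ∀ {a b : ℝ}, 0 ≤ a → 0 ≤ b →
      IntervalIntegrable (fun s ↦ (φ s ^ 2)⁻¹ • tailIntegral φ f s) volume a b := fun ha hb ↦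
    (ContinuousOn.memL2Loc (w.continuousOn_invSq_smul_tailIntegral hf)).intervalIntegrable ha hb
  -- Beyond this threshold the contributions from N are absorbed by half of the target ε ·
  -- `invSqIntegral φ x`.
  have h2 := w.tendsto_invSqIntegral.eventually_gt_atTop
    (2 / ε * (‖greenQuotient φ f N‖ + |ε / 2 * invSqIntegral φ N|))
  filter_upwards [h2, eventually_ge_atTop N, w.tendsto_invSqIntegral.eventually_gt_atTop 0]
    with x hx2 hxN hx0
  have hx : 0 ≤ x := hN0.trans hxN
  have key : ‖greenQuotient φ f x - greenQuotient φ f N‖ ≤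
      ε / 2 * (invSqIntegral φ x - invSqIntegral φ N) := by
    rw [w.invSqIntegral_sub hN0 hx, ← intervalIntegral.integral_const_mul]
    unfold greenQuotient
    rw [intervalIntegral.integral_interval_sub_left (hI le_rfl hx) (hI le_rfl hN0)]
    refine intervalIntegral.norm_integral_le_of_norm_le hxN (ae_of_all _ fun s hs ↦ ?_)
      ((w.intervalIntegrable_invSq hN0 hx).const_mul _)
    have hs0 := w.pos s (hN0.trans hs.1.le)
    rw [norm_smul, Real.norm_of_nonneg (by positivity), mul_comm]
    gcongr
    simpa using (hN s hs.1.le).1.le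
  have h3 : ‖greenQuotient φ f x‖ ≤ ‖greenQuotient φ f N‖ +
      ε / 2 * (invSqIntegral φ x - invSqIntegral φ N) := by
    have := norm_sub_norm_le (greenQuotient φ f x) (greenQuotient φ f N)
    linarith
  rw [dist_zero_right, norm_div, Complex.norm_real, Real.norm_of_nonneg hx0.le, div_lt_iff₀ hx0]
  have h4 : ‖greenQuotient φ f N‖ + |ε / 2 * invSqIntegral φ N| < ε / 2 * invSqIntegral φ x := by
    rw [div_mul_eq_mul_div, div_lt_iff₀ hε] at hx2
    linarith
  have := neg_abs_le (ε / 2 * invSqIntegral φ N)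
  nlinarith

theorem integral_greenKernel_mul {f : ℝ → ℂ} (hf : MemLp f 2 halfLine) {x : ℝ} (hx : 0 ≤ x) :
    ∫ y in Ioi (0 : ℝ), (greenKernel φ x y : ℂ) * f y = φ x * greenQuotient φ f x := by
  -- The integrand lives on 0 < s ≤ x, s ≤ y: integrating y first gives the tail integral,
  -- integrating s first gives ∫_0^{min(x,y)} φ⁻².
  let F : ℝ → ℝ → ℂ := fun s y ↦
    indicator {p : ℝ × ℝ | p.1 ≤ p.2}
      (fun p ↦ (((φ p.1 ^ 2)⁻¹ : ℝ) : ℂ) * ((φ p.2 : ℂ) * f p.2)) (s, y)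
  have hF : Integrable (Function.uncurry F) ((volume.restrict (Ioc 0 x)).prod halfLine) := by
    have h1 : Integrable (fun s ↦ (((φ s ^ 2)⁻¹ : ℝ) : ℂ)) (volume.restrict (Ioc 0 x)) := by
      have := w.intervalIntegrable_invSq le_rfl hx
      rw [intervalIntegrable_iff_integrableOn_Ioc_of_le hx] at this
      exact Integrable.ofReal this
    exact (h1.mul_prod (w.integrable_mul hf)).indicator
      (measurableSet_le measurable_fst measurable_snd)
  have hswap := integral_integral_swap hF
  have hl : ∫ s in Ioc 0 x, ∫ y in Ioi (0 : ℝ), F s y = greenQuotient φ f x := by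
    unfold greenQuotient
    rw [intervalIntegral.integral_of_le hx]
    refine setIntegral_congr_fun measurableSet_Ioc fun s hs ↦ ?_
    have e : ∀ y, F s y = (Ici s).indicator
        (fun y ↦ (((φ s ^ 2)⁻¹ : ℝ) : ℂ) * ((φ y : ℂ) * f y)) y := fun y ↦ rfl
    simp only [e]
    rw [setIntegral_indicator measurableSet_Ici,
      inter_eq_right.2 (Ici_subset_Ioi.2 hs.1), integral_Ici_eq_integral_Ioi,
      integral_const_mul, Complex.real_smul]
    rfl
  rw [← hl, hswap, ← integral_const_mul]
  refine setIntegral_congr_fun measurableSet_Ioi fun y hy ↦ ?_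
  have hy0 : 0 ≤ min x y := le_min hx (le_of_lt hy)
  have e : ∀ s, F s y = (Iic y).indicator (fun s ↦ (((φ s ^ 2)⁻¹ : ℝ) : ℂ)) s *
      ((φ y : ℂ) * f y) := by
    intro s
    by_cases h : s ≤ y
    · simp [F, h]
    · simp [F, h]
  simp only [e]
  rw [integral_mul_const, setIntegral_indicator measurableSet_Iic, Ioc_inter_Iic, integral_complex_ofReal,
    ← intervalIntegral.integral_of_le hy0, greenKernel_eq]
  simp only [invSqIntegral]
  push_cast
  ring

/-- The first conjunct records that the tail integral of |f| is real and nonnegative, so that it can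
be replaced by its norm. -/
theorem norm_tailIntegral_le (f : ℝ → ℂ) {s : ℝ} (hs : 0 ≤ s) :
    tailIntegral φ (fun y ↦ (‖f y‖ : ℂ)) s = ‖tailIntegral φ (fun y ↦ (‖f y‖ : ℂ)) s‖ ∧
    ‖tailIntegral φ f s‖ ≤ ‖tailIntegral φ (fun y ↦ (‖f y‖ : ℂ)) s‖ := by
  have e : tailIntegral φ (fun y ↦ (‖f y‖ : ℂ)) s = ((∫ y in Ioi s, φ y * ‖f y‖ : ℝ) : ℂ) := by
    rw [← integral_complex_ofReal]
    simp [tailIntegral]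
  have hn : ∀ y ∈ Ioi s, ‖(φ y : ℂ) * f y‖ = φ y * ‖f y‖ := fun y hy ↦ by
    rw [norm_mul, Complex.norm_real, Real.norm_of_nonneg (w.pos y (hs.trans (le_of_lt hy))).le]
  have h1 : ‖tailIntegral φ f s‖ ≤ ∫ y in Ioi s, φ y * ‖f y‖ := by
    rw [← setIntegral_congr_fun measurableSet_Ioi hn]
    exact norm_integral_le_integral_norm _
  have h0 := (norm_nonneg _).trans h1
  rw [e, Complex.norm_real, Real.norm_of_nonneg h0]
  exact ⟨rfl, h1⟩

/-- Absolute convergence for f is controlled by the potential of |f|, to which the boundedness of G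
applies. -/
theorem integral_norm_le_norm_greenQuotient {f : ℝ → ℂ} (hf : MemLp f 2 halfLine) {x : ℝ}
    (hx : 0 ≤ x) :
    ∫ s in (0 : ℝ)..x, ‖(φ s ^ 2)⁻¹ • tailIntegral φ f s‖ ≤
      ‖greenQuotient φ (fun y ↦ (‖f y‖ : ℂ)) x‖ := by
  have hf' : MemLp (fun y ↦ (‖f y‖ : ℂ)) 2 halfLine := hf.norm.ofReal
  have hI : ∀ {g : ℝ → ℂ}, MemLp g 2 halfLine →
      IntervalIntegrable (fun s ↦ (φ s ^ 2)⁻¹ • tailIntegral φ g s) volume 0 x := fun hg ↦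
    (ContinuousOn.memL2Loc (w.continuousOn_invSq_smul_tailIntegral hg)).intervalIntegrable le_rfl hx
  have e : greenQuotient φ (fun y ↦ (‖f y‖ : ℂ)) x =
      ((∫ s in (0 : ℝ)..x, ‖(φ s ^ 2)⁻¹ • tailIntegral φ (fun y ↦ (‖f y‖ : ℂ)) s‖ : ℝ) : ℂ) := by
    rw [← intervalIntegral.integral_ofReal]
    refine intervalIntegral.integral_congr fun s hs ↦ ?_
    rw [uIcc_of_le hx] at hs
    rw [norm_smul, Real.norm_of_nonneg (inv_nonneg.2 (sq_nonneg _)), Complex.ofReal_mul,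
      ← (w.norm_tailIntegral_le f hs.1).1, Complex.real_smul]
  rw [e, Complex.norm_real]
  refine le_trans ?_ (le_abs_self _)
  refine intervalIntegral.integral_mono_on hx (hI hf).norm (hI hf').norm fun s hs ↦ ?_
  rw [norm_smul, norm_smul]
  exact mul_le_mul_of_nonneg_left (w.norm_tailIntegral_le f hs.1).2 (norm_nonneg _)

/-- The quadratic form of the Green potential, obtained by exchanging the order of integration. -/
theorem integral_mul_star_green {a b : ℝ → ℂ} (ha : MemLp a 2 halfLine) (hb : MemLp b 2 halfLine)
    (hG : MemLp (fun x ↦ (φ x : ℂ) * greenQuotient φ (fun y ↦ (‖b y‖ : ℂ)) x) 2 halfLine) :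
    Integrable (fun s ↦ tailIntegral φ a s * star (tailIntegral φ b s) * ((φ s : ℂ) ^ 2)⁻¹)
        halfLine ∧
      ∫ x in Ioi (0 : ℝ), a x * star ((φ x : ℂ) * greenQuotient φ b x) =
        ∫ s in Ioi (0 : ℝ),
          tailIntegral φ a s * star (tailIntegral φ b s) * ((φ s : ℂ) ^ 2)⁻¹ := by
  have hc := w.continuousOn_invSq_smul_tailIntegral hb
  set t : ℝ → ℂ := fun s ↦ (φ s ^ 2)⁻¹ • tailIntegral φ b s with ht
  let F : ℝ → ℝ → ℂ := fun x s ↦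
    indicator {p : ℝ × ℝ | p.2 ≤ p.1} (fun p ↦ ((φ p.1 : ℂ) * a p.1) * star (t p.2)) (x, s)
  have eF : ∀ x s, F x s = (Iic x).indicator (fun s ↦ ((φ x : ℂ) * a x) * star (t s)) s :=
    fun x s ↦ rfl
  have hmeas : AEStronglyMeasurable (Function.uncurry F) (halfLine.prod halfLine) := by
    have h1 : AEStronglyMeasurable (fun s ↦ star (t s)) halfLine :=
      (continuous_star.comp_continuousOn (hc.mono Ioi_subset_Ici_self)).aestronglyMeasurable
        measurableSet_Ioi
    have h2 := (w.integrable_mul ha).aestronglyMeasurable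
    exact ((h2.comp_fst (ν := halfLine)).mul (h1.comp_snd (μ := halfLine))).indicator
      (measurableSet_le measurable_snd measurable_fst)
  have hti : ∀ x, 0 ≤ x → IntervalIntegrable t volume 0 x := fun x hx ↦
    (ContinuousOn.memL2Loc hc).intervalIntegrable le_rfl hx
  have hinner : ∀ x ∈ Ioi (0 : ℝ), Integrable (F x) halfLine := by
    intro x hx
    have h1 := hti x (le_of_lt hx)
    rw [intervalIntegrable_iff_integrableOn_Ioc_of_le (le_of_lt hx), ← Ioi_inter_Iic] at h1
    have h2 : IntegrableOn (fun s ↦ star (t s)) (Ioi 0 ∩ Iic x) :=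
      ⟨h1.aestronglyMeasurable.star, by simpa [HasFiniteIntegral] using h1.2⟩
    change IntegrableOn (F x) (Ioi 0)
    have : F x = (Iic x).indicator (fun s ↦ ((φ x : ℂ) * a x) * star (t s)) := funext (eF x)
    rw [this, IntegrableOn, integrable_indicator_iff measurableSet_Iic, IntegrableOn,
      Measure.restrict_restrict measurableSet_Iic, inter_comm]
    exact h2.const_mul _
  have hnorm : ∀ x ∈ Ioi (0 : ℝ), ∫ s in Ioi (0 : ℝ), ‖F x s‖ ≤
      ‖a x‖ * ‖(φ x : ℂ) * greenQuotient φ (fun y ↦ (‖b y‖ : ℂ)) x‖ := by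
    intro x hx
    have hx' : (0 : ℝ) ≤ x := le_of_lt hx
    have e : ∀ s, ‖F x s‖ = (Iic x).indicator (fun s ↦ ‖(φ x : ℂ) * a x‖ * ‖t s‖) s := by
      intro s
      rw [eF, norm_indicator_eq_indicator_norm]
      simp only [norm_mul, norm_star]
    simp only [e]
    rw [setIntegral_indicator measurableSet_Iic, Ioi_inter_Iic, integral_const_mul,
      ← intervalIntegral.integral_of_le hx', norm_mul, norm_mul, mul_comm ‖(φ x : ℂ)‖, mul_assoc]
    gcongr
    exact w.integral_norm_le_norm_greenQuotient hb hx'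
  have hint : Integrable (Function.uncurry F) (halfLine.prod halfLine) := by
    rw [integrable_prod_iff hmeas]
    refine ⟨?_, ?_⟩
    · filter_upwards [ae_restrict_mem measurableSet_Ioi] with x hx using hinner x hx
    -- The bound |a| · |G|b|| is a product of two L² functions, hence integrable.
    · refine Integrable.mono' (MemLp.integrable_mul (p := 2) (q := 2) ha.norm hG.norm)
        hmeas.norm.integral_prod_right' ?_
      filter_upwards [ae_restrict_mem measurableSet_Ioi] with x hx
      rw [Real.norm_of_nonneg (integral_nonneg fun s ↦ norm_nonneg _)]
      exact hnorm x hx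
  have hl : ∀ x ∈ Ioi (0 : ℝ), a x * star ((φ x : ℂ) * greenQuotient φ b x) =
      ∫ s in Ioi (0 : ℝ), F x s := by
    intro x hx
    have hx' : (0 : ℝ) ≤ x := le_of_lt hx
    simp only [eF]
    rw [setIntegral_indicator measurableSet_Iic, Ioi_inter_Iic, integral_const_mul]
    have : ∫ s in Ioc 0 x, star (t s) = star (greenQuotient φ b x) := by
      unfold greenQuotient
      rw [intervalIntegral.integral_of_le hx']
      exact integral_conj
    rw [this]
    simp only [star_mul', RCLike.star_def, Complex.conj_ofReal]
    ring
  have hr : ∀ s ∈ Ioi (0 : ℝ), ∫ x in Ioi (0 : ℝ), F x s =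
      tailIntegral φ a s * star (tailIntegral φ b s) * ((φ s : ℂ) ^ 2)⁻¹ := by
    intro s hs
    have e : ∀ x, F x s = (Ici s).indicator (fun x ↦ ((φ x : ℂ) * a x) * star (t s)) x :=
      fun x ↦ rfl
    simp only [e]
    rw [setIntegral_indicator measurableSet_Ici,
      inter_eq_right.2 (Ici_subset_Ioi.2 hs), integral_Ici_eq_integral_Ioi,
      integral_mul_const]
    simp only [ht, Complex.real_smul, star_mul', RCLike.star_def, Complex.conj_ofReal, tailIntegral]
    push_cast
    ring
  constructor
  · refine hint.integral_prod_right.congr ?_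
    filter_upwards [ae_restrict_mem measurableSet_Ioi] with s hs using hr s hs
  · rw [setIntegral_congr_fun measurableSet_Ioi hl, integral_integral_swap hint]
    exact setIntegral_congr_fun measurableSet_Ioi hr

/-! ### Identification of 𝒟 with the Green potentials. -/

theorem hasWeakDeriv_of_eqOn_green {f g : ℝ → ℂ} (hf : MemLp f 2 halfLine)
    (hg : EqOn g (fun x ↦ (φ x : ℂ) * greenQuotient φ f x) (Ici 0)) {φ' : ℝ → ℝ}
    (hφ : HasWeakDeriv φ φ') :
    HasWeakDeriv g (fun x ↦ φ x • ((φ x ^ 2)⁻¹ • tailIntegral φ f x) +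
      φ' x • greenQuotient φ f x) :=
  (hφ.smul (w.hasWeakDeriv_greenQuotient hf)).congr hg

theorem hasWeakDeriv_div_of_eqOn_green {f g : ℝ → ℂ} (hf : MemLp f 2 halfLine)
    (hg : EqOn g (fun x ↦ (φ x : ℂ) * greenQuotient φ f x) (Ici 0)) :
    HasWeakDeriv (fun x ↦ g x / (φ x : ℂ)) (fun s ↦ (φ s ^ 2)⁻¹ • tailIntegral φ f s) :=
  (w.hasWeakDeriv_greenQuotient hf).congr fun x hx ↦ by
    have : (φ x : ℂ) ≠ 0 := Complex.ofReal_ne_zero.2 (w.pos x hx).ne'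
    simp only [hg hx]
    field_simp

/-- For g = φq the terms φφ'q cancel, leaving φ²q', and q' = φ⁻² times the tail integral. -/
theorem wronskian_ae_eq {f g : ℝ → ℂ} (hf : MemLp f 2 halfLine)
    (hg : EqOn g (fun x ↦ (φ x : ℂ) * greenQuotient φ f x) (Ici 0)) :
    wronskian φ g =ᵐ[halfLine] tailIntegral φ f := by
  obtain ⟨φ', hφ⟩ := w.memW
  filter_upwards [hφ.weakDeriv_ae_eq ae_eq_rfl,
    (w.hasWeakDeriv_of_eqOn_green hf hg hφ).weakDeriv_ae_eq ae_eq_rfl,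
    ae_restrict_mem measurableSet_Ioi] with x h1 h2 hx
  have hx' : x ∈ Ici (0 : ℝ) := Ioi_subset_Ici_self hx
  have : (φ x : ℂ) ≠ 0 := Complex.ofReal_ne_zero.2 (w.pos x hx').ne'
  simp only [wronskian, h1, h2, hg hx', Complex.real_smul]
  push_cast
  field_simp
  ring

theorem weakDeriv_wronskian_ae_eq {f g : ℝ → ℂ} (hf : MemLp f 2 halfLine)
    (hg : EqOn g (fun x ↦ (φ x : ℂ) * greenQuotient φ f x) (Ici 0)) :
    weakDeriv (wronskian φ g) =ᵐ[halfLine] fun x ↦ -((φ x : ℂ) * f x) :=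
  (w.hasWeakDeriv_tailIntegral hf).weakDeriv_ae_eq (w.wronskian_ae_eq hf hg)

theorem memDomainD_of_eqOn_green {f g : ℝ → ℂ} (hf : MemLp f 2 halfLine)
    (hg : EqOn g (fun x ↦ (φ x : ℂ) * greenQuotient φ f x) (Ici 0)) (hg2 : MemLp g 2 halfLine) :
    MemDomainD φ g where
  memLp := hg2
  memW := by
    obtain ⟨φ', hφ⟩ := w.memW
    exact ⟨_, w.hasWeakDeriv_of_eqOn_green hf hg hφ⟩
  apply_zero := by
    rw [hg (by simp : (0 : ℝ) ∈ Ici (0 : ℝ))]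
    simp [greenQuotient]
  wronskian_memW := ⟨_, _, w.wronskian_ae_eq hf hg, w.hasWeakDeriv_tailIntegral hf⟩
  deriv_memLp := by
    refine hf.neg.ae_eq ?_
    filter_upwards [w.weakDeriv_wronskian_ae_eq hf hg, ae_restrict_mem measurableSet_Ioi]
      with x h hx
    have : (φ x : ℂ) ≠ 0 := Complex.ofReal_ne_zero.2 (w.pos x (le_of_lt hx)).ne'
    rw [h, Pi.neg_apply]
    field_simp
  tendsto := by
    refine (w.tendsto_greenQuotient_div hf).congr' ?_
    filter_upwards [eventually_ge_atTop (0 : ℝ)] with x hx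
    have : (φ x : ℂ) ≠ 0 := Complex.ofReal_ne_zero.2 (w.pos x hx).ne'
    rw [hg hx, psi_eq, Complex.ofReal_mul]
    exact (mul_div_mul_left _ _ this).symm

/-- Every element of `𝒟` is a Green potential. -/
theorem exists_eqOn_green {g : ℝ → ℂ} (hg : MemDomainD φ g) :
    ∃ f : ℝ → ℂ, MemLp f 2 halfLine ∧
      EqOn g (fun x ↦ (φ x : ℂ) * greenQuotient φ f x) (Ici 0) := by
  obtain ⟨φ', hφ⟩ := w.memW
  obtain ⟨g', hg'⟩ := hg.memW
  obtain ⟨k', k, hk, hkk'⟩ := hg.wronskian_memW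
  -- The only possible density, since a Green potential of f has Wronskian derivative -φf.
  set f : ℝ → ℂ := fun x ↦ -((φ x : ℂ)⁻¹ * weakDeriv (wronskian φ g) x) with hfdef
  have hf : MemLp f 2 halfLine := hg.deriv_memLp.neg
  have hT := w.hasWeakDeriv_tailIntegral hf
  have hT' : HasWeakDeriv (tailIntegral φ f) k' := by
    refine hT.congr_ae_deriv ?_
    filter_upwards [hkk'.weakDeriv_ae_eq hk, ae_restrict_mem measurableSet_Ioi] with x h hx
    have : (φ x : ℂ) ≠ 0 := Complex.ofReal_ne_zero.2 (w.pos x (le_of_lt hx)).ne'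
    rw [hfdef, ← h]
    field_simp
  -- The Wronskian and the tail integral have the same weak derivative, so they differ by this
  -- constant.
  set c : ℂ := k 0 - tailIntegral φ f 0 with hc
  have hkc : ∀ x, 0 ≤ x → k x = tailIntegral φ f x + c := fun x hx ↦ by
    rw [hkk'.eq_integral x hx, hT'.eq_integral x hx, hc]; ring
  have hq : HasWeakDeriv (fun x ↦ (φ x)⁻¹ • g x)
      (fun s ↦ (φ s ^ 2)⁻¹ • tailIntegral φ f s + (φ s ^ 2)⁻¹ • c) := by
    refine ((hφ.inv w.pos).smul hg').congr_ae_deriv ?_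
    filter_upwards [hk, hφ.weakDeriv_ae_eq ae_eq_rfl, hg'.weakDeriv_ae_eq ae_eq_rfl,
      ae_restrict_mem measurableSet_Ioi] with x h1 h2 h3 hx
    have hx' : (0 : ℝ) ≤ x := le_of_lt hx
    have : (φ x : ℂ) ≠ 0 := Complex.ofReal_ne_zero.2 (w.pos x hx').ne'
    rw [← smul_add, ← hkc x hx', ← h1]
    simp only [wronskian, h2, h3, Complex.real_smul, smul_eq_mul]
    push_cast
    field_simp
    ring
  have hgq : ∀ x, 0 ≤ x → (φ x)⁻¹ • g x = greenQuotient φ f x + invSqIntegral φ x • c := by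
    intro x hx
    have hI : IntervalIntegrable (fun s ↦ (φ s ^ 2)⁻¹ • c) volume 0 x :=
      (ContinuousOn.memL2Loc (w.continuousOn_invSq.smul continuousOn_const)).intervalIntegrable
        le_rfl hx
    rw [hq.eq_integral x hx, hg.apply_zero, smul_zero, zero_add,
      intervalIntegral.integral_add ((ContinuousOn.memL2Loc
        (w.continuousOn_invSq_smul_tailIntegral hf)).intervalIntegrable le_rfl hx) hI,
      intervalIntegral.integral_smul_const]
    rfl
  have hlim := (w.tendsto_greenQuotient_div hf).add_const c
  -- The quotient g/ψ tends to c by the formula just obtained, and to 0 by (D5).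
  have hc0 : c = 0 := by
    refine (zero_add c).symm.trans (tendsto_nhds_unique (hlim.congr' ?_) hg.tendsto)
    filter_upwards [eventually_ge_atTop (0 : ℝ), w.tendsto_invSqIntegral.eventually_gt_atTop 0]
      with x hx hx2
    have h1 : (φ x : ℂ) ≠ 0 := Complex.ofReal_ne_zero.2 (w.pos x hx).ne'
    have h2 : (invSqIntegral φ x : ℂ) ≠ 0 := Complex.ofReal_ne_zero.2 hx2.ne'
    have h3 := hgq x hx
    simp only [Complex.real_smul, Complex.ofReal_inv] at h3
    rw [inv_mul_eq_iff_eq_mul₀ h1] at h3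
    rw [psi_eq, Complex.ofReal_mul, h3]
    field_simp
  refine ⟨f, hf, fun x hx ↦ ?_⟩
  have h1 : (φ x : ℂ) ≠ 0 := Complex.ofReal_ne_zero.2 (w.pos x hx).ne'
  have h3 := hgq x hx
  rw [hc0, smul_zero, add_zero, Complex.real_smul, Complex.ofReal_inv,
    inv_mul_eq_iff_eq_mul₀ h1] at h3
  exact h3

/-- Differentiating twice strips off the two integrations; the factors φ⁻² and φ never vanish. -/
theorem ae_eq_zero_of_greenQuotient {f : ℝ → ℂ} (hf : MemLp f 2 halfLine)
    (h : greenQuotient φ f =ᵐ[halfLine] 0) : f =ᵐ[halfLine] 0 := by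
  have h0 : HasWeakDeriv (0 : ℝ → ℂ) 0 :=
    HasWeakDeriv.of_integral (c := 0) (fun _ ↦ MemLp.zero) fun x _ ↦ by simp
  have h1 := (w.hasWeakDeriv_greenQuotient hf).ae_unique h0 h
  have h2 : tailIntegral φ f =ᵐ[halfLine] 0 := by
    filter_upwards [h1, ae_restrict_mem measurableSet_Ioi] with x hx hx0
    exact (smul_eq_zero.1 hx).resolve_left
      (inv_ne_zero (pow_ne_zero 2 (w.pos x (le_of_lt hx0)).ne'))
  filter_upwards [(w.hasWeakDeriv_tailIntegral hf).ae_unique h0 h2,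
    ae_restrict_mem measurableSet_Ioi] with x hx hx0
  exact (mul_eq_zero.1 (neg_eq_zero.1 hx)).resolve_left
    (Complex.ofReal_ne_zero.2 (w.pos x (le_of_lt hx0)).ne')

end IsPositiveL2Weight

/-! ### Inverses of injective bounded operators: self-adjointness and spectrum. -/

section InverseOperator

variable {E : Type*} [NormedAddCommGroup E]

section Normed

variable [NormedSpace ℂ E] {G : E →L[ℂ] E}

theorem mem_inverseOperator_domain {u : E} :
    u ∈ (inverseOperator G).domain ↔ ∃ f, G f = u := by
  rw [inverseOperator, LinearPMap.inverse_domain]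
  constructor
  · rintro ⟨f, hf⟩
    exact ⟨f, hf⟩
  · rintro ⟨f, hf⟩
    exact ⟨⟨f, trivial⟩, hf⟩

theorem inverseOperator_apply (hG : Function.Injective G) (u : (inverseOperator G).domain) {f : E}
    (h : G f = u) : inverseOperator G u = f := by
  refine LinearPMap.inverse_apply_eq (f := (G : E →ₗ[ℂ] E).toPMap ⊤) ?_
    (y := u) (x := ⟨f, trivial⟩) h
  rw [LinearMap.ker_eq_bot']
  intro m hm
  have : G m = 0 := hm
  exact Subtype.ext (hG (by rw [this]; simp))

theorem inverseOperator_apply_apply (hG : Function.Injective G) (f : E)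
    (h : G f ∈ (inverseOperator G).domain) : inverseOperator G ⟨G f, h⟩ = f :=
  inverseOperator_apply hG _ rfl

theorem apply_inverseOperator (hG : Function.Injective G) (u : (inverseOperator G).domain) :
    G (inverseOperator G u) = u := by
  obtain ⟨f, hf⟩ := mem_inverseOperator_domain.1 u.2
  rw [inverseOperator_apply hG u hf, hf]

theorem mem_resolventSetPMap_inverseOperator_zero (hG : Function.Injective G) :
    (0 : ℂ) ∈ resolventSetPMap (inverseOperator G) := by
  refine ⟨G, fun v ↦ ⟨⟨G v, mem_inverseOperator_domain.2 ⟨v, rfl⟩⟩, rfl, ?_⟩, fun u ↦ ?_⟩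
  · rw [inverseOperator_apply_apply hG, zero_smul, sub_zero]
  · rw [zero_smul, sub_zero, apply_inverseOperator hG]

/-- For z ≠ 0, H - z = z(z⁻¹ - G)H on the domain of H, so if z⁻¹ - G is invertible then z⁻¹G(z⁻¹ -
G)⁻¹ is the resolvent of H at z. -/
theorem inv_mem_spectrum_of_mem_spectrumPMap (hG : Function.Injective G) {z : ℂ}
    (hz : z ∈ spectrumPMap (inverseOperator G)) : z ≠ 0 ∧ z⁻¹ ∈ spectrum ℂ G := by
  have hz0 : z ≠ 0 := fun h ↦ hz (h ▸ mem_resolventSetPMap_inverseOperator_zero hG)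
  refine ⟨hz0, fun hres ↦ hz ?_⟩
  obtain ⟨S, hS⟩ := (hres : IsUnit (algebraMap ℂ (E →L[ℂ] E) z⁻¹ - G))
  have hr : ∀ v, z⁻¹ • (S⁻¹.1 v) - G (S⁻¹.1 v) = v := fun v ↦ by
    have := DFunLike.congr_fun S.mul_inv v
    rw [hS] at this
    simpa [Algebra.algebraMap_eq_smul_one] using this
  have hl : ∀ v, S⁻¹.1 (z⁻¹ • v - G v) = v := fun v ↦ by
    have := DFunLike.congr_fun S.inv_mul v
    rw [hS] at this
    simpa [Algebra.algebraMap_eq_smul_one] using this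
  refine ⟨z⁻¹ • (G * S⁻¹.1), fun v ↦ ⟨⟨G (z⁻¹ • S⁻¹.1 v), mem_inverseOperator_domain.2 ⟨_, rfl⟩⟩,
    by simp, ?_⟩, fun u ↦ ?_⟩
  · rw [inverseOperator_apply_apply hG]
    simp only [map_smul, smul_smul, mul_inv_cancel₀ hz0, one_smul]
    exact hr v
  · obtain ⟨f, hf⟩ := mem_inverseOperator_domain.1 u.2
    rw [inverseOperator_apply hG u hf, ← hf]
    have e : f - z • G f = z • (z⁻¹ • f - G f) := by
      rw [smul_sub, smul_smul, mul_inv_cancel₀ hz0, one_smul]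
    rw [e, map_smul, smul_apply, smul_smul, mul_inv_cancel₀ hz0, one_smul]
    change G (S⁻¹.1 _) = _
    rw [hl]

end Normed

variable [InnerProductSpace ℂ E] [CompleteSpace E] {G : E →L[ℂ] E}

theorem isSelfAdjoint_inverseOperator (hG : Function.Injective G)
    (hs : ∀ x y, inner ℂ (G x) y = inner ℂ x (G y)) : IsSelfAdjoint (inverseOperator G) := by
  have hdense : Dense ((inverseOperator G).domain : Set E) := by
    rw [Submodule.dense_iff_topologicalClosure_eq_top, Submodule.topologicalClosure_eq_top_iff,
      Submodule.eq_bot_iff]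
    intro v hv
    -- Testing v ⊥ Ran G against G(Gv) gives ‖Gv‖² = 0.
    have h1 := (Submodule.mem_orthogonal _ v).1 hv (G (G v))
      (mem_inverseOperator_domain.2 ⟨_, rfl⟩)
    rw [hs, inner_self_eq_zero] at h1
    exact hG (by rw [h1, map_zero])
  rw [LinearPMap.isSelfAdjoint_def]
  have hformal : (inverseOperator G).IsFormalAdjoint (inverseOperator G) := fun x y ↦ by
    rw [← apply_inverseOperator hG x, ← apply_inverseOperator hG y, hs]
  refine (LinearPMap.eq_of_le_of_domain_eq (hformal.le_adjoint hdense)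
    (le_antisymm (hformal.le_adjoint hdense).1 fun y hy ↦ ?_)).symm
  -- For y in the domain of H*, ⟨G(H*y), v⟩ = ⟨H*y, Gv⟩ = ⟨y, HGv⟩ = ⟨y, v⟩ for all v, so y =
  -- G(H*y).
  refine mem_inverseOperator_domain.2 ⟨(inverseOperator G).adjoint ⟨y, hy⟩, ?_⟩
  refine ext_inner_right ℂ fun v ↦ ?_
  have := LinearPMap.adjoint_isFormalAdjoint hdense ⟨y, hy⟩
    ⟨G v, mem_inverseOperator_domain.2 ⟨v, rfl⟩⟩
  rw [inverseOperator_apply_apply hG] at this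
  rw [hs]
  exact this

open ComplexOrder in
theorem spectrumPMap_inverseOperator_subset (hG : Function.Injective G) (hp : G.IsPositive) :
    spectrumPMap (inverseOperator G) ⊆ (fun r : ℝ ↦ (r : ℂ)) '' Ici ‖G‖⁻¹ := by
  intro z hz
  obtain ⟨hz0, hzs⟩ := inv_mem_spectrum_of_mem_spectrumPMap hG hz
  have h0 : 0 ≤ z⁻¹ :=
    spectrum_nonneg_of_nonneg ((ContinuousLinearMap.nonneg_iff_isPositive G).2 hp) hzs
  have hn : ‖z‖⁻¹ ≤ ‖G‖ := by
    -- On the zero space every operator is invertible, so a spectral point rules that case out.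
    have : Nontrivial E := by
      by_contra hE
      rw [not_nontrivial_iff_subsingleton] at hE
      have : Subsingleton (E →L[ℂ] E) := inferInstance
      exact hzs (isUnit_of_subsingleton _)
    rw [← norm_inv]
    exact spectrum.norm_le_norm_of_mem hzs
  have hz' : 0 ≤ z := inv_nonneg.1 h0
  have hzn : z = ((‖z‖ : ℝ) : ℂ) := by
    exact (RCLike.norm_of_nonneg' hz').symm
  exact ⟨‖z‖, inv_le_of_inv_le₀ (norm_pos_iff.2 hz0) hn, hzn.symm⟩

end InverseOperator


/-! ### The Green operator and the quadratic form of its inverse. -/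

namespace IsGreenOperator

variable {φ : ℝ → ℝ} {G : L2HalfLine →L[ℂ] L2HalfLine}

theorem ae_eq (hG : IsGreenOperator φ G) (w : IsPositiveL2Weight φ) (f : L2HalfLine) :
    (G f : ℝ → ℂ) =ᵐ[halfLine] fun x ↦ (φ x : ℂ) * greenQuotient φ f x := by
  filter_upwards [hG f, ae_restrict_mem measurableSet_Ioi] with x hx h0
  rw [hx, w.integral_greenKernel_mul (Lp.memLp f) (le_of_lt h0)]

/-- Applied to |b|, this supplies the domination needed for Fubini in the quadratic form. -/
theorem memLp_green (hG : IsGreenOperator φ G) (w : IsPositiveL2Weight φ) {f : ℝ → ℂ}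
    (hf : MemLp f 2 halfLine) :
    MemLp (fun x ↦ (φ x : ℂ) * greenQuotient φ f x) 2 halfLine := by
  refine (Lp.memLp (G (hf.toLp f))).ae_eq ?_
  filter_upwards [hG.ae_eq w (hf.toLp f), ae_restrict_mem measurableSet_Ioi] with x hx h0
  rw [hx, greenQuotient_congr hf.coeFn_toLp (le_of_lt h0)]

theorem injective (hG : IsGreenOperator φ G) (w : IsPositiveL2Weight φ) :
    Function.Injective G := by
  rw [injective_iff_map_eq_zero]
  intro f hf
  have h1 := hG.ae_eq w f
  rw [hf] at h1
  refine (Lp.eq_zero_iff_ae_eq_zero).2 (w.ae_eq_zero_of_greenQuotient (Lp.memLp f) ?_)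
  filter_upwards [h1, Lp.coeFn_zero ℂ 2 halfLine, ae_restrict_mem measurableSet_Ioi]
    with x hx hx2 h0
  rw [hx2] at hx
  exact (mul_eq_zero.1 hx.symm).resolve_left
    (Complex.ofReal_ne_zero.2 (w.pos x (le_of_lt h0)).ne')

theorem inner_apply_eq_integral (hG : IsGreenOperator φ G) (w : IsPositiveL2Weight φ)
    (a b : L2HalfLine) :
    Integrable (fun s ↦ tailIntegral φ a s * star (tailIntegral φ b s) * ((φ s : ℂ) ^ 2)⁻¹)
        halfLine ∧
      inner ℂ (G b) a = ∫ s in Ioi (0 : ℝ),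
        tailIntegral φ a s * star (tailIntegral φ b s) * ((φ s : ℂ) ^ 2)⁻¹ := by
  obtain ⟨h1, h2⟩ := w.integral_mul_star_green (Lp.memLp a) (Lp.memLp b)
    (hG.memLp_green w (Lp.memLp b).norm.ofReal)
  refine ⟨h1, ?_⟩
  rw [← h2, L2.inner_def]
  refine integral_congr_ae ?_
  filter_upwards [hG.ae_eq w b] with x hx
  rw [hx, RCLike.inner_apply]
  rfl

/-- Exchanging a and b conjugates the integrand of the form, because φ is real. -/
theorem inner_symm (hG : IsGreenOperator φ G) (w : IsPositiveL2Weight φ) (a b : L2HalfLine) :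
    inner ℂ (G a) b = inner ℂ a (G b) := by
  rw [← inner_conj_symm a (G b), (hG.inner_apply_eq_integral w a b).2,
    (hG.inner_apply_eq_integral w b a).2, ← integral_conj]
  congr 1 with s
  simp only [map_mul, map_inv₀, map_pow, RCLike.star_def, Complex.conj_conj, Complex.conj_ofReal]
  ring

open ComplexOrder in
theorem isPositive (hG : IsGreenOperator φ G) (w : IsPositiveL2Weight φ) : G.IsPositive := by
  rw [ContinuousLinearMap.isPositive_iff]
  refine ⟨fun a b ↦ hG.inner_symm w a b, fun a ↦ ?_⟩
  rw [(hG.inner_apply_eq_integral w a a).2]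
  have e : ∀ s, tailIntegral φ a s * star (tailIntegral φ a s) * ((φ s : ℂ) ^ 2)⁻¹ =
      ((‖tailIntegral φ a s‖ ^ 2 * (φ s ^ 2)⁻¹ : ℝ) : ℂ) := fun s ↦ by
    rw [RCLike.star_def, Complex.mul_conj, Complex.normSq_eq_norm_sq]
    push_cast
    rfl
  simp only [e]
  rw [integral_complex_ofReal, Complex.zero_le_real]
  exact integral_nonneg fun s ↦ by positivity

/-- Both sides are continuous on [0,∞), so a.e. equality becomes equality everywhere, including at
0. -/
theorem eqOn_of_ae_eq (hG : IsGreenOperator φ G) (w : IsPositiveL2Weight φ) {f : L2HalfLine}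
    {g : ℝ → ℂ} (hg : MemDomainD φ g) (h : (G f : ℝ → ℂ) =ᵐ[halfLine] g) :
    EqOn g (fun x ↦ (φ x : ℂ) * greenQuotient φ f x) (Ici 0) := by
  obtain ⟨φ', hφ⟩ := w.memW
  obtain ⟨g', hg'⟩ := hg.memW
  exact hg'.eqOn_of_ae_eq (w.hasWeakDeriv_of_eqOn_green (Lp.memLp f) (fun _ _ ↦ rfl) hφ)
    (h.symm.trans (hG.ae_eq w f))

theorem mem_inverseOperator_domain_iff (hG : IsGreenOperator φ G) (w : IsPositiveL2Weight φ)
    (u : L2HalfLine) : u ∈ (inverseOperator G).domain ↔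
      ∃ g : ℝ → ℂ, MemDomainD φ g ∧ (u : ℝ → ℂ) =ᵐ[halfLine] g := by
  rw [mem_inverseOperator_domain]
  constructor
  · rintro ⟨f, rfl⟩
    exact ⟨_, w.memDomainD_of_eqOn_green (Lp.memLp f) (fun _ _ ↦ rfl)
      (hG.memLp_green w (Lp.memLp f)), hG.ae_eq w f⟩
  · rintro ⟨g, hg, hu⟩
    obtain ⟨f, hf, hgf⟩ := w.exists_eqOn_green hg
    refine ⟨hf.toLp f, Lp.ext ?_⟩
    filter_upwards [hG.ae_eq w (hf.toLp f), hu, ae_restrict_mem measurableSet_Ioi]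
      with x h1 h2 h0
    rw [h1, h2, hgf (Ioi_subset_Ici_self h0),
      greenQuotient_congr hf.coeFn_toLp (le_of_lt h0)]

/-- Here φ'g - φg' is minus the tail integral, whose weak derivative is φf; dividing by φ returns f.
-/
theorem inverseOperator_ae_eq (hG : IsGreenOperator φ G) (w : IsPositiveL2Weight φ)
    (u : (inverseOperator G).domain) {g : ℝ → ℂ} (hg : MemDomainD φ g)
    (hu : ((u : L2HalfLine) : ℝ → ℂ) =ᵐ[halfLine] g) :
    (inverseOperator G u : ℝ → ℂ) =ᵐ[halfLine] fun x ↦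
      (φ x : ℂ)⁻¹ *
        weakDeriv (fun t ↦ ((weakDeriv φ t : ℝ) : ℂ) * g t - (φ t : ℂ) * weakDeriv g t) x := by
  obtain ⟨f, hf⟩ := mem_inverseOperator_domain.1 u.2
  rw [inverseOperator_apply (hG.injective w) u hf]
  rw [← hf] at hu
  have hgf := hG.eqOn_of_ae_eq w hg hu
  have hw : (fun t ↦ ((weakDeriv φ t : ℝ) : ℂ) * g t - (φ t : ℂ) * weakDeriv g t) =ᵐ[halfLine]
      fun t ↦ -tailIntegral φ f t := by
    filter_upwards [w.wronskian_ae_eq (Lp.memLp f) hgf] with t ht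
    rw [← ht, wronskian]
    ring
  filter_upwards [(w.hasWeakDeriv_tailIntegral (Lp.memLp f)).neg.weakDeriv_ae_eq hw,
    ae_restrict_mem measurableSet_Ioi] with x hx h0
  have : (φ x : ℂ) ≠ 0 := Complex.ofReal_ne_zero.2 (w.pos x (le_of_lt h0)).ne'
  rw [hx, neg_neg, inv_mul_cancel_left₀ this]

theorem quadraticForm_wronskian (hG : IsGreenOperator φ G) (w : IsPositiveL2Weight φ)
    {f₁ f₂ : L2HalfLine} {g₁ g₂ : ℝ → ℂ}
    (h₁ : EqOn g₁ (fun x ↦ (φ x : ℂ) * greenQuotient φ f₁ x) (Ici 0))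
    (h₂ : EqOn g₂ (fun x ↦ (φ x : ℂ) * greenQuotient φ f₂ x) (Ici 0)) :
    Integrable (fun x ↦ ((φ x : ℂ) * weakDeriv g₁ x - ((weakDeriv φ x : ℝ) : ℂ) * g₁ x) *
        ((φ x : ℂ) * star (weakDeriv g₂ x) - ((weakDeriv φ x : ℝ) : ℂ) * star (g₂ x)) *
        ((φ x : ℂ) ^ 2)⁻¹) halfLine ∧
      inner ℂ (G f₂) f₁ =
        ∫ x in Ioi (0 : ℝ), ((φ x : ℂ) * weakDeriv g₁ x - ((weakDeriv φ x : ℝ) : ℂ) * g₁ x) *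
          ((φ x : ℂ) * star (weakDeriv g₂ x) - ((weakDeriv φ x : ℝ) : ℂ) * star (g₂ x)) *
          ((φ x : ℂ) ^ 2)⁻¹ := by
  obtain ⟨hi, he⟩ := hG.inner_apply_eq_integral w f₁ f₂
  have key : (fun s ↦ tailIntegral φ f₁ s * star (tailIntegral φ f₂ s) * ((φ s : ℂ) ^ 2)⁻¹)
      =ᵐ[halfLine] fun x ↦
        ((φ x : ℂ) * weakDeriv g₁ x - ((weakDeriv φ x : ℝ) : ℂ) * g₁ x) *
        ((φ x : ℂ) * star (weakDeriv g₂ x) - ((weakDeriv φ x : ℝ) : ℂ) * star (g₂ x)) *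
        ((φ x : ℂ) ^ 2)⁻¹ := by
    filter_upwards [w.wronskian_ae_eq (Lp.memLp f₁) h₁, w.wronskian_ae_eq (Lp.memLp f₂) h₂]
      with x hx₁ hx₂
    rw [← hx₁, ← hx₂]
    simp only [wronskian, star_sub, star_mul', RCLike.star_def, Complex.conj_ofReal]
  exact ⟨hi.congr key, he.trans (integral_congr_ae key)⟩

/-- Since (g/φ)' = φ⁻²T, the weight φ² turns the product φ⁻⁴ into the φ⁻² of the form. -/
theorem quadraticForm_quotient (hG : IsGreenOperator φ G) (w : IsPositiveL2Weight φ)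
    {f₁ f₂ : L2HalfLine} {g₁ g₂ : ℝ → ℂ}
    (h₁ : EqOn g₁ (fun x ↦ (φ x : ℂ) * greenQuotient φ f₁ x) (Ici 0))
    (h₂ : EqOn g₂ (fun x ↦ (φ x : ℂ) * greenQuotient φ f₂ x) (Ici 0)) :
    MemW (fun x ↦ g₁ x / (φ x : ℂ)) ∧ MemW (fun x ↦ star (g₂ x) / (φ x : ℂ)) ∧
      Integrable (fun x ↦ weakDeriv (fun t ↦ g₁ t / (φ t : ℂ)) x *
        weakDeriv (fun t ↦ star (g₂ t) / (φ t : ℂ)) x * (φ x : ℂ) ^ 2) halfLine ∧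
      inner ℂ (G f₂) f₁ =
        ∫ x in Ioi (0 : ℝ), weakDeriv (fun t ↦ g₁ t / (φ t : ℂ)) x *
          weakDeriv (fun t ↦ star (g₂ t) / (φ t : ℂ)) x * (φ x : ℂ) ^ 2 := by
  obtain ⟨hi, he⟩ := hG.inner_apply_eq_integral w f₁ f₂
  have d₁ := w.hasWeakDeriv_div_of_eqOn_green (Lp.memLp f₁) h₁
  have d₂ : HasWeakDeriv (fun x ↦ star (g₂ x) / (φ x : ℂ))
      (fun s ↦ star ((φ s ^ 2)⁻¹ • tailIntegral φ f₂ s)) := by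
    refine (w.hasWeakDeriv_div_of_eqOn_green (Lp.memLp f₂) h₂).star.congr fun x _ ↦ ?_
    simp only [RCLike.star_def, map_div₀, Complex.conj_ofReal]
  have key : (fun s ↦ tailIntegral φ f₁ s * star (tailIntegral φ f₂ s) * ((φ s : ℂ) ^ 2)⁻¹)
      =ᵐ[halfLine] fun x ↦ weakDeriv (fun t ↦ g₁ t / (φ t : ℂ)) x *
        weakDeriv (fun t ↦ star (g₂ t) / (φ t : ℂ)) x * (φ x : ℂ) ^ 2 := by
    filter_upwards [d₁.weakDeriv_ae_eq ae_eq_rfl, d₂.weakDeriv_ae_eq ae_eq_rfl,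
      ae_restrict_mem measurableSet_Ioi] with x hx₁ hx₂ h0
    have : (φ x : ℂ) ≠ 0 := Complex.ofReal_ne_zero.2 (w.pos x (le_of_lt h0)).ne'
    rw [hx₁, hx₂]
    simp only [Complex.real_smul, star_mul', RCLike.star_def, Complex.conj_ofReal]
    push_cast
    field_simp
  exact ⟨⟨_, d₁⟩, ⟨_, d₂⟩, hi.congr key, he.trans (integral_congr_ae key)⟩

end IsGreenOperator

end


/-- Mathlib's `inner ℂ a b` is conjugate-linear in `a`, so the form `⟨Hg₁, g₂⟩`, which here
is linear in the first variable, is `inner ℂ g₂ (H g₁)`. -/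
theorem theorem4p4 (φ : ℝ → ℝ)
    (hφ_pos : ∀ x : ℝ, 0 ≤ x → 0 < φ x)
    (hφ_W : MemW φ)
    (hφ_L2 : MemLp φ 2 halfLine)
    (G : L2HalfLine →L[ℂ] L2HalfLine)
    (hG : IsGreenOperator φ G) :
    -- `G` is injective, so that `H = G⁻¹` makes sense, and `H` is self-adjoint
    Function.Injective G ∧
    IsSelfAdjoint (inverseOperator G) ∧
    -- the domain of `H` is `𝒟`
    (∀ u : L2HalfLine, u ∈ (inverseOperator G).domain ↔
      ∃ g : ℝ → ℂ, MemDomainD φ g ∧ (u : ℝ → ℂ) =ᵐ[halfLine] g) ∧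
    -- `H g = φ⁻¹ (φ' g - φ g')'`
    (∀ (u : (inverseOperator G).domain) (g : ℝ → ℂ), MemDomainD φ g →
      ((u : L2HalfLine) : ℝ → ℂ) =ᵐ[halfLine] g →
      (inverseOperator G u : ℝ → ℂ) =ᵐ[halfLine] fun x ↦
        (φ x : ℂ)⁻¹ *
          weakDeriv (fun t ↦ ((weakDeriv φ t : ℝ) : ℂ) * g t - (φ t : ℂ) * weakDeriv g t) x) ∧
    -- `Spec(H) ⊆ [‖G‖⁻¹, ∞)`
    (spectrumPMap (inverseOperator G) ⊆ (fun r : ℝ ↦ (r : ℂ)) '' Ici ‖G‖⁻¹) ∧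
    -- the boundary condition
    (∀ g : ℝ → ℂ, MemDomainD φ g → g 0 = 0) ∧
    -- the quadratic form, in its two expressions
    (∀ (u₁ u₂ : (inverseOperator G).domain) (g₁ g₂ : ℝ → ℂ),
      MemDomainD φ g₁ → ((u₁ : L2HalfLine) : ℝ → ℂ) =ᵐ[halfLine] g₁ →
      MemDomainD φ g₂ → ((u₂ : L2HalfLine) : ℝ → ℂ) =ᵐ[halfLine] g₂ →
      (Integrable (fun x ↦ ((φ x : ℂ) * weakDeriv g₁ x - ((weakDeriv φ x : ℝ) : ℂ) * g₁ x) *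
          ((φ x : ℂ) * star (weakDeriv g₂ x) - ((weakDeriv φ x : ℝ) : ℂ) * star (g₂ x)) *
          ((φ x : ℂ) ^ 2)⁻¹) halfLine ∧
        inner ℂ (u₂ : L2HalfLine) (inverseOperator G u₁) =
          ∫ x in Ioi (0 : ℝ), ((φ x : ℂ) * weakDeriv g₁ x - ((weakDeriv φ x : ℝ) : ℂ) * g₁ x) *
            ((φ x : ℂ) * star (weakDeriv g₂ x) - ((weakDeriv φ x : ℝ) : ℂ) * star (g₂ x)) *
            ((φ x : ℂ) ^ 2)⁻¹) ∧
      (MemW (fun x ↦ g₁ x / (φ x : ℂ)) ∧ MemW (fun x ↦ star (g₂ x) / (φ x : ℂ)) ∧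
        Integrable (fun x ↦ weakDeriv (fun t ↦ g₁ t / (φ t : ℂ)) x *
          weakDeriv (fun t ↦ star (g₂ t) / (φ t : ℂ)) x * (φ x : ℂ) ^ 2) halfLine ∧
        inner ℂ (u₂ : L2HalfLine) (inverseOperator G u₁) =
          ∫ x in Ioi (0 : ℝ), weakDeriv (fun t ↦ g₁ t / (φ t : ℂ)) x *
            weakDeriv (fun t ↦ star (g₂ t) / (φ t : ℂ)) x * (φ x : ℂ) ^ 2)) := by
  have w : IsPositiveL2Weight φ := ⟨hφ_pos, hφ_W, hφ_L2⟩
  have hinj := hG.injective w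
  refine ⟨hinj, isSelfAdjoint_inverseOperator hinj (hG.inner_symm w),
    hG.mem_inverseOperator_domain_iff w, fun u g hg hu ↦ hG.inverseOperator_ae_eq w u hg hu,
    spectrumPMap_inverseOperator_subset hinj (hG.isPositive w), fun g hg ↦ hg.apply_zero, ?_⟩
  intro u₁ u₂ g₁ g₂ hg₁ hu₁ hg₂ hu₂
  -- Writing uᵢ = G(Huᵢ) makes each gᵢ the Green potential of fᵢ = Huᵢ, and the form becomes `inner
  -- ℂ (G f₂) f₁`.
  rw [← apply_inverseOperator hinj] at hu₁ hu₂
  have h₁ := hG.eqOn_of_ae_eq w hg₁ hu₁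
  have h₂ := hG.eqOn_of_ae_eq w hg₂ hu₂
  rw [← apply_inverseOperator hinj u₂]
  exact ⟨hG.quadraticForm_wronskian w h₁ h₂, hG.quadraticForm_quotient w h₁ h₂⟩
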